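/- Let $\mathcal F$ be the class of continuous distribution functions $F$ on $\mathbb R$ with $F(0)=0$ that have a probability density $f$ which is the sum of its Maclaurin series at every positive point: $$f(x)=\sum_{q=0}^{\infty}\frac{f^{(q)}(0)}{q!}\,x^q\qquad\text{for all }x>0,$$ where $f^{(q)}(0)$ denotes the $q$-th derivative at $0$ from the right. Let $n\ge 2$ and let $X_1,\dots,X_n$ be independent random variables with common distribution function $F\in\mathcal F$. If $$X_1+\tfrac12X_2+\cdots+\tfrac1nX_n\ \overset{d}{=}\ X_{(n;n)},\qquad X_{(n;n)}=\max\{X_1,\dots,X_n\},$$ then $F$ is exponential: there is $\lambda>0$ such that $F(x)=1-e^{-\lambda x}$ for all $x\ge 0$. -/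

import Mathlib

/-- `f` is a probability density of the law `μ` on `ℝ`. -/
structure IsDensity (μ : MeasureTheory.Measure ℝ) (f : ℝ → ℝ) : Prop where
  measurable : Measurable f
  nonneg : ∀ x, 0 ≤ f x
  eq_withDensity : μ = MeasureTheory.volume.withDensity (fun x => ENNReal.ofReal (f x))

/-- `f` is the sum of its Maclaurin series at every `x > 0`. The derivatives at `0` are taken from
the right (within `[0, ∞)`), since `f` usually vanishes on the negative half-line and jumps at
`0`. -/
def HasMaclaurinExpansion (f : ℝ → ℝ) : Prop :=
  ∀ x : ℝ, 0 < x →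
    HasSum (fun q : ℕ => iteratedDerivWithin q f (Set.Ici 0) 0 / (q.factorial : ℝ) * x ^ q) (f x)

/-- The class `𝓕` of laws whose distribution function `F` is continuous with `F 0 = 0` and which
have a density that is the sum of its Maclaurin series for all `x > 0`. -/
structure MemClassF (μ : MeasureTheory.Measure ℝ) : Prop where
  isProbabilityMeasure : MeasureTheory.IsProbabilityMeasure μ
  continuous_cdf : Continuous (ProbabilityTheory.cdf μ)
  cdf_zero : ProbabilityTheory.cdf μ 0 = 0
  exists_density : ∃ f : ℝ → ℝ, IsDensity μ f ∧ HasMaclaurinExpansion f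

/-- The sample maximum, i.e. the order statistic `X_(n;n)` (for `n ≥ 1`). -/
noncomputable def sampleMax {Ω : Type*} {n : ℕ} (X : Fin n → Ω → ℝ) (ω : Ω) : ℝ :=
  ⨆ i, X i ω

/-- The sum `X₁ + X₂ / 2 + ⋯ + Xₙ / n`; the sample is indexed from `0`. -/
noncomputable def harmonicSum {Ω : Type*} {n : ℕ} (X : Fin n → Ω → ℝ) (ω : Ω) : ℝ :=
  ∑ i : Fin n, X i ω / ((i : ℝ) + 1)

/-! Write f(x) = ∑ aₘ xᵐ/m! and A = ∑ aₘ Xᵐ. Under the Borel transform, convolution on [0, ∞)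
becomes X times the product of series, so the weighted sum has distribution function the transform
of ∏ᵢ iX·A(iX) (`sumsTo_measureReal_sum_le`), while the maximum has the n-th power of the transform
of X·A. Uniqueness of coefficients (`SumsTo.unique`) turns equality in law into [Xʳ] (∑ aₘ
Xᵐ/(m+1)!)ⁿ = n!/(n+r)! · [Xʳ] ∏ᵢ A(iX) for all r. Geometric sequences solve this: both sides
generate Stirling numbers of the second kind (`coeff_pow_exp_eq`). Nothing else does
(`exists_geometric_of_coeff_identity`): a strict factorial inequality forces a₀ ≠ 0, and at the
first order r ≥ 2 where a departs from a₀ρʳ, ρ = a₁/a₀, linearising gives n/(r+1)! = n!/(n+r)! · ∑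
iʳ, which is false. A geometric sequence gives F = (a₀/ρ)(exp(ρx) − 1), and F being a distribution
function forces ρ < 0 and a₀ = −ρ. -/

/-! ### First-order perturbation of products of power series. -/

open PowerSeries in
/-- The derivative of a product in the direction of a perturbation of order `X ^ r`. -/
theorem exists_prod_sub_prod_eq {ι : Type*} (s : Finset ι) (u v w : ι → ℝ⟦X⟧) (c : ℝ) (r : ℕ)
    (hu : ∀ i ∈ s, constantCoeff (u i) = c) (hv : ∀ i ∈ s, constantCoeff (v i) = c)
    (h : ∀ i ∈ s, u i - v i = X ^ r * w i) :
    ∃ W : ℝ⟦X⟧, ∏ i ∈ s, u i - ∏ i ∈ s, v i = X ^ r * W ∧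
      c * constantCoeff W = c ^ s.card * ∑ i ∈ s, constantCoeff (w i) := by
  classical
  induction s using Finset.induction_on with
  | empty => exact ⟨0, by simp⟩
  | insert i s hi ih =>
    obtain ⟨W, hW, hW0⟩ := ih (fun j hj => hu j (Finset.mem_insert_of_mem hj))
      (fun j hj => hv j (Finset.mem_insert_of_mem hj))
      (fun j hj => h j (Finset.mem_insert_of_mem hj))
    have hi' := h i (Finset.mem_insert_self i s)
    refine ⟨w i * ∏ j ∈ s, u j + v i * W, ?_, ?_⟩
    · rw [Finset.prod_insert hi, Finset.prod_insert hi]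
      linear_combination (∏ j ∈ s, u j) * hi' + v i * hW
    · have hP : constantCoeff (∏ j ∈ s, u j) = c ^ s.card := by
        rw [map_prod, Finset.prod_congr rfl fun j hj => hu j (Finset.mem_insert_of_mem hj)]
        simp
      rw [map_add, map_mul, map_mul, hP, hv i (Finset.mem_insert_self i s),
        Finset.card_insert_of_notMem hi, Finset.sum_insert hi]
      linear_combination c * hW0

-- At order r only one factor at a time can deviate, the others contributing their constant term c.
-- The extra c on the left avoids the exponent `s.card - 1`.
open PowerSeries in
theorem coeff_prod_sub_coeff_prod {ι : Type*} (s : Finset ι) (u v : ι → ℝ⟦X⟧) (c : ℝ) (r : ℕ)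
    (hu : ∀ i ∈ s, constantCoeff (u i) = c) (hv : ∀ i ∈ s, constantCoeff (v i) = c)
    (h : ∀ i ∈ s, ∀ m < r, coeff m (u i) = coeff m (v i)) :
    c * (coeff r (∏ i ∈ s, u i) - coeff r (∏ i ∈ s, v i)) =
      c ^ s.card * ∑ i ∈ s, (coeff r (u i) - coeff r (v i)) := by
  have h' : ∀ i, ∃ w, i ∈ s → u i - v i = X ^ r * w := by
    intro i
    by_cases hi : i ∈ s
    · obtain ⟨w, hw⟩ := (X_pow_dvd_iff (n := r) (φ := u i - v i)).2
        (fun m hm => by rw [map_sub, h i hi m hm, sub_self])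
      exact ⟨w, fun _ => hw⟩
    · exact ⟨0, fun h => absurd h hi⟩
  choose w hw using h'
  have hr : ∀ W : ℝ⟦X⟧, coeff r (X ^ r * W) = constantCoeff W := fun W => by
    simpa using coeff_X_pow_mul W r 0
  obtain ⟨W, hW, hW0⟩ := exists_prod_sub_prod_eq s u v w c r hu hv hw
  rw [← map_sub, hW, hr, hW0]
  congr 1
  refine Finset.sum_congr rfl fun i hi => ?_
  rw [← map_sub, hw i hi, hr]

/-! ### Factorial and power-sum inequalities. -/

/-- Comparison of consecutive power sums. -/
theorem add_mul_sum_pow_le (q n : ℕ) :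
    (n + q + 1) * ∑ i ∈ Finset.range n, (i + 1) ^ q ≤
      (q + 2) * ∑ i ∈ Finset.range n, (i + 1) ^ (q + 1) := by
  induction n with
  | zero => simp
  | succ n ih =>
    have hs : ∑ i ∈ Finset.range n, (i + 1) ^ q ≤ n * (n + 1) ^ q := by
      calc ∑ i ∈ Finset.range n, (i + 1) ^ q ≤ ∑ i ∈ Finset.range n, (n + 1) ^ q :=
            Finset.sum_le_sum fun i hi => Nat.pow_le_pow_left (by
              have := Finset.mem_range.1 hi; omega) q
        _ = n * (n + 1) ^ q := by simp
    rw [Finset.sum_range_succ, Finset.sum_range_succ]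
    have : n * (n + 1) ^ q ≤ (q + 1) * (n * (n + 1) ^ q) := Nat.le_mul_of_pos_left _ (by omega)
    have e : (n + 1) ^ (q + 1) = (n + 1) ^ q * (n + 1) := pow_succ _ _
    rw [e]
    nlinarith

theorem six_mul_sum_sq (n : ℕ) :
    6 * ∑ i ∈ Finset.range n, (i + 1) ^ 2 = n * (n + 1) * (2 * n + 1) := by
  induction n with
  | zero => simp
  | succ n ih => rw [Finset.sum_range_succ, mul_add, ih]; ring

/-- The exponent starts at 2 because exponents 0 and 1 give equality, which is why a₀ and a₁ stay
free. -/
theorem mul_factorial_lt_factorial_mul_sum_pow {n : ℕ} (hn : 2 ≤ n) (r : ℕ) :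
    n * (n + (r + 2)).factorial <
      n.factorial * (r + 3).factorial * ∑ i ∈ Finset.range n, (i + 1) ^ (r + 2) := by
  induction r with
  | zero =>
    have h6 := six_mul_sum_sq n
    have hf := n.factorial_pos
    have : (n + (0 + 2)).factorial = (n + 2) * ((n + 1) * n.factorial) := by
      rw [zero_add, Nat.factorial_succ, Nat.factorial_succ]
    rw [this]
    have h3 : (0 + 3).factorial = 6 := rfl
    rw [h3, mul_assoc, zero_add, h6]
    have : n * (n + 1) * (n + 2) < n * (n + 1) * (2 * n + 1) := by
      apply Nat.mul_lt_mul_of_pos_left <;> first | positivity | omega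
    nlinarith
  | succ r ih =>
    have h := add_mul_sum_pow_le (r + 2) n
    have e1 : (n + (r + 1 + 2)).factorial = (n + (r + 2) + 1) * (n + (r + 2)).factorial :=
      Nat.factorial_succ _
    have e2 : (r + 1 + 3).factorial = (r + 2 + 2) * (r + 3).factorial := Nat.factorial_succ _
    have e3 : r + 1 + 2 = r + 2 + 1 := by omega
    rw [e1, e2, e3]
    calc n * ((n + (r + 2) + 1) * (n + (r + 2)).factorial)
        = (n + (r + 2) + 1) * (n * (n + (r + 2)).factorial) := by ring
      _ < (n + (r + 2) + 1) * (n.factorial * (r + 3).factorial *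
            ∑ i ∈ Finset.range n, (i + 1) ^ (r + 2)) :=
          Nat.mul_lt_mul_of_pos_left ih (by omega)
      _ = n.factorial * (r + 3).factorial * ((n + (r + 2) + 1) *
            ∑ i ∈ Finset.range n, (i + 1) ^ (r + 2)) := by ring
      _ ≤ n.factorial * (r + 3).factorial * ((r + 2 + 2) *
            ∑ i ∈ Finset.range n, (i + 1) ^ (r + 2 + 1)) := Nat.mul_le_mul_left _ h
      _ = _ := by ring

/-- Factor by factor, mn + k + 1 ≥ (n + 1)(k + 1) for k < m. -/
theorem succ_pow_mul_factorial_lt_ascFactorial {m n : ℕ} (hm : 2 ≤ m) (hn : 1 ≤ n) :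
    (n + 1) ^ m * m.factorial < (m * n + 1).ascFactorial m := by
  obtain ⟨l, rfl⟩ : ∃ l, m = l + 1 := ⟨m - 1, by omega⟩
  -- the first of the factors is strictly larger
  have key : ∀ l' ≤ l, (n + 1) ^ (l' + 1) * (l' + 1).factorial + 1 ≤
      ((l + 1) * n + 1).ascFactorial (l' + 1) := by
    intro l'
    induction l' with
    | zero =>
      intro _
      simp only [zero_add, pow_one, Nat.factorial_one, mul_one, Nat.ascFactorial_succ,
        Nat.ascFactorial_zero, add_zero]
      nlinarith
    | succ k ih =>
      intro hk
      have ih := ih (by omega)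
      rw [Nat.ascFactorial_succ, Nat.factorial_succ, pow_succ]
      calc (n + 1) ^ (k + 1) * (n + 1) * ((k + 1 + 1) * (k + 1).factorial) + 1
          ≤ ((n + 1) * (k + 2)) * ((n + 1) ^ (k + 1) * (k + 1).factorial + 1) := by
            have : 1 ≤ (n + 1) * (k + 2) := Nat.mul_pos (by omega) (by omega)
            nlinarith
        _ ≤ _ := by
            refine Nat.mul_le_mul ?_ ih
            nlinarith [Nat.mul_le_mul_right n hk]
  exact key l le_rfl

/-- Applied with m = k + 1, where k is the first index with aₖ ≠ 0; m = 1 would give equality. -/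
theorem factorial_pow_mul_factorial_pow_lt {m : ℕ} (hm : 2 ≤ m) {n : ℕ} (hn : 2 ≤ n) :
    n.factorial ^ m * m.factorial ^ n < (m * n).factorial := by
  have step : ∀ k, (m * (k + 1)).factorial = (m * k).factorial * (m * k + 1).ascFactorial m :=
    fun k => by rw [Nat.factorial_mul_ascFactorial, mul_add, mul_one]
  induction n, hn using Nat.le_induction with
  | base =>
    have h := succ_pow_mul_factorial_lt_ascFactorial hm le_rfl
    have := step 1
    have hf := m.factorial_pos
    rw [mul_one] at *
    rw [this]
    rw [Nat.factorial_two, pow_two, ← mul_assoc, mul_comm]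
    exact Nat.mul_lt_mul_of_pos_left h hf
  | succ k hk ih =>
    have h := succ_pow_mul_factorial_lt_ascFactorial hm (show 1 ≤ k by omega)
    rw [step, Nat.factorial_succ, mul_pow, pow_succ]
    calc (k + 1) ^ m * k.factorial ^ m * (m.factorial ^ k * m.factorial)
        = (k.factorial ^ m * m.factorial ^ k) * ((k + 1) ^ m * m.factorial) := by ring
      _ < _ := Nat.mul_lt_mul'' ih h

/-! ### The coefficient identity and its solutions. -/

open PowerSeries in
/-- The Stirling-type recursion: geometric sequences solve the coefficient identity. -/
theorem coeff_pow_exp_eq (ρ : ℝ) (n r : ℕ) :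
    coeff r ((mk fun m => ρ ^ m / ((m + 1).factorial : ℝ)) ^ n) =
      (n.factorial : ℝ) / ((n + r).factorial : ℝ) *
        coeff r (∏ i ∈ Finset.range n, rescale ((i : ℝ) + 1) (mk fun m => ρ ^ m)) := by
  set e : ℝ⟦X⟧ := mk fun m => ρ ^ m / ((m + 1).factorial : ℝ) with he
  set K : ℕ → ℝ⟦X⟧ := fun n =>
    ∏ i ∈ Finset.range n, rescale ((i : ℝ) + 1) (mk fun m => ρ ^ m) with hK
  change coeff r (e ^ n) = _ * coeff r (K n)
  have hfac : ∀ m : ℕ, (m.factorial : ℝ) ≠ 0 := fun m => by exact_mod_cast m.factorial_ne_zero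
  -- `X * e` is (exp(ρX) − 1)/ρ; the differential equation also covers ρ = 0.
  have hd : d⁄dX ℝ (X * e) = 1 + C ρ * (X * e) := by
    ext m
    rw [coeff_derivative, coeff_succ_X_mul, map_add, coeff_C_mul, he, coeff_mk]
    cases m with
    | zero => simp
    | succ m =>
      rw [coeff_succ_X_mul, coeff_mk, coeff_one, if_neg (by omega),
        Nat.factorial_succ (m + 1), pow_succ]
      have := hfac (m + 1)
      push_cast
      field_simp
      ring
  have hw : ∀ n r, coeff (n + r) ((X * e) ^ n) = coeff r (e ^ n) := fun n r => by
    rw [mul_pow, add_comm, coeff_X_pow_mul]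
  have hh : ∀ n r : ℕ, ((n : ℝ) + 1 + (r + 1)) * coeff (r + 1) (e ^ (n + 1)) =
      (n + 1) * coeff (r + 1) (e ^ n) + (n + 1) * ρ * coeff r (e ^ (n + 1)) := by
    intro n r
    have h1 : d⁄dX ℝ ((X * e) ^ (n + 1)) =
        C ((n : ℝ) + 1) * ((X * e) ^ n) + C (((n : ℝ) + 1) * ρ) * (X * e) ^ (n + 1) := by
      rw [Derivation.leibniz_pow, hd]
      simp only [nsmul_eq_mul, smul_eq_mul, Nat.add_sub_cancel, map_mul, map_add, map_natCast,
        map_one]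
      push_cast
      ring
    have h2 := congrArg (coeff (n + r + 1)) h1
    rw [coeff_derivative, map_add, coeff_C_mul, coeff_C_mul,
      show n + r + 1 + 1 = (n + 1) + (r + 1) by omega, hw,
      show n + r + 1 = n + (r + 1) by omega, hw,
      show n + (r + 1) = (n + 1) + r by omega, hw] at h2
    rw [← h2]
    push_cast
    ring
  -- Clearing the last factor 1/(1 − (n+1)ρX) gives the same recursion as `hh`, up to the
  -- normalisation n!/(n+r)!.
  have hk : ∀ n r : ℕ, coeff (r + 1) (K (n + 1)) =
      coeff (r + 1) (K n) + ((n : ℝ) + 1) * ρ * coeff r (K (n + 1)) := by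
    intro n r
    have h1 : (rescale ((n : ℝ) + 1) (mk fun m => ρ ^ m)) * (1 - C (((n : ℝ) + 1) * ρ) * X) =
        1 := by
      ext m
      rw [mul_sub, mul_one, map_sub, ← mul_assoc, mul_comm _ (C _), mul_assoc, coeff_C_mul]
      cases m with
      | zero => simp
      | succ m =>
        rw [coeff_succ_mul_X, coeff_rescale, coeff_rescale, coeff_mk, coeff_mk, coeff_one,
          if_neg (by omega)]
        ring
    have h2 : K (n + 1) = K n + C (((n : ℝ) + 1) * ρ) * (X * K (n + 1)) := by
      have : K (n + 1) = K n * rescale ((n : ℝ) + 1) (mk fun m => ρ ^ m) :=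
        Finset.prod_range_succ _ _
      rw [this]
      linear_combination (K n) * h1
    have h3 := congrArg (coeff (r + 1)) h2
    rwa [map_add, coeff_C_mul, coeff_succ_X_mul] at h3
  induction n generalizing r with
  | zero =>
    cases r with
    | zero => simp [K]
    | succ r => simp [K, coeff_one]
  | succ n ih =>
    induction r with
    | zero =>
      simp only [coeff_zero_eq_constantCoeff, map_pow, hK, map_prod, add_zero]
      rw [div_self (hfac _)]
      simp [he, ← coeff_zero_eq_constantCoeff_apply]
    | succ r ihr =>
      have h1 := hh n r
      have hpos : ((n : ℝ) + 1 + (r + 1)) ≠ 0 := by positivity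
      rw [ih, ihr] at h1
      apply mul_left_cancel₀ hpos
      rw [h1, hk, show n + 1 + (r + 1) = (n + 1 + r) + 1 by omega,
        show n + (r + 1) = n + 1 + r by omega, Nat.factorial_succ (n + 1 + r),
        Nat.factorial_succ n]
      have := hfac (n + 1 + r)
      push_cast
      have : (n : ℝ) + 1 + r + 1 ≠ 0 := by positivity
      field_simp
      ring

open PowerSeries in
/-- Only geometric sequences solve the coefficient identity. -/
theorem exists_geometric_of_coeff_identity {n : ℕ} (hn : 2 ≤ n) (a : ℕ → ℝ) (ha : ∃ q, a q ≠ 0)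
    (h : ∀ r, coeff r ((mk fun m => a m / ((m + 1).factorial : ℝ)) ^ n) =
      (n.factorial : ℝ) / ((n + r).factorial : ℝ) *
        coeff r (∏ i ∈ Finset.range n, rescale ((i : ℝ) + 1) (mk a))) :
    a 0 ≠ 0 ∧ ∀ m, a m = a 0 * (a 1 / a 0) ^ m := by
  classical
  have hfac : ∀ m : ℕ, (m.factorial : ℝ) ≠ 0 := fun m => by exact_mod_cast m.factorial_ne_zero
  have h0 : a 0 ≠ 0 := by
    set k := Nat.find ha with hk
    have hak : a k ≠ 0 := Nat.find_spec ha
    have hlt : ∀ m < k, a m = 0 := fun m hm => not_not.1 (Nat.find_min ha hm)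
    by_contra h0
    have hk0 : k ≠ 0 := fun h => hak (h ▸ h0)
    have hX : ∀ b : ℕ → ℝ, (∀ m < k, b m = 0) →
        (mk b : ℝ⟦X⟧) = X ^ k * mk (fun m => b (m + k)) := fun b hb => by
      ext m
      rw [coeff_X_pow_mul', coeff_mk]
      split_ifs with hm
      · rw [coeff_mk, Nat.sub_add_cancel hm]
      · exact hb m (by omega)
    -- Order kn is the lowest that survives on either side; it gives aₖⁿ/(k+1)!ⁿ = n!ᵏ⁺¹
    -- aₖⁿ/((k+1)n)!.
    have h1 := h (k * n)
    rw [hX (fun m => a m / ((m + 1).factorial : ℝ)) (fun m hm => by simp [hlt m hm]),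
      hX a hlt, mul_pow, ← pow_mul] at h1
    have h2 : ∏ i ∈ Finset.range n, rescale ((i : ℝ) + 1) (X ^ k * mk (fun m => a (m + k))) =
        X ^ (k * n) * (C ((n.factorial : ℝ) ^ k) *
          ∏ i ∈ Finset.range n, rescale ((i : ℝ) + 1) (mk (fun m => a (m + k)))) := by
      simp only [map_mul, map_pow, rescale_X, mul_pow, Finset.prod_mul_distrib, Finset.prod_const,
        Finset.card_range, ← pow_mul]
      have : ∏ i ∈ Finset.range n, (C ((i : ℝ) + 1)) ^ k = (C (n.factorial : ℝ) : ℝ⟦X⟧) ^ k := by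
        rw [Finset.prod_pow, ← map_prod, ← Finset.prod_range_add_one_eq_factorial]
        push_cast
        rfl
      rw [this]
      ring
    rw [h2] at h1
    have hr : ∀ W : ℝ⟦X⟧, coeff (k * n) (X ^ (k * n) * W) = constantCoeff W := fun W => by
      simpa using coeff_X_pow_mul W (k * n) 0
    rw [hr, hr] at h1
    have hc : ∀ b : ℕ → ℝ, constantCoeff (mk b) = b 0 := fun b => by
      rw [← coeff_zero_eq_constantCoeff_apply, coeff_mk]
    have hres : ∀ (c : ℝ) (u : ℝ⟦X⟧), constantCoeff (rescale c u) = constantCoeff u :=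
      fun c u => by
        rw [← coeff_zero_eq_constantCoeff_apply, coeff_rescale, pow_zero, one_mul,
          coeff_zero_eq_constantCoeff_apply]
    simp only [map_pow, map_mul, map_prod, hres, hc, constantCoeff_C, Finset.prod_const,
      Finset.card_range, zero_add] at h1
    have hlt' := factorial_pow_mul_factorial_pow_lt (show 2 ≤ k + 1 by omega) hn
    have heq : ((n.factorial ^ (k + 1) * (k + 1).factorial ^ n : ℕ) : ℝ) =
        (((k + 1) * n).factorial : ℕ) := by
      have han : a k ^ n ≠ 0 := pow_ne_zero _ hak
      have e : n + k * n = (k + 1) * n := by ring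
      rw [e, div_pow] at h1
      have := hfac (k + 1)
      have := hfac ((k + 1) * n)
      field_simp at h1
      push_cast
      rw [pow_succ]
      linear_combination -h1
    exact hlt'.ne (by exact_mod_cast heq)
  refine ⟨h0, fun m => ?_⟩
  set ρ := a 1 / a 0 with hρ
  have hstar : ∀ r, coeff r ((mk fun m => a 0 * ρ ^ m / ((m + 1).factorial : ℝ)) ^ n) =
      (n.factorial : ℝ) / ((n + r).factorial : ℝ) *
        coeff r (∏ i ∈ Finset.range n, rescale ((i : ℝ) + 1) (mk fun m => a 0 * ρ ^ m)) := by
    intro r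
    have e1 : (mk fun m => a 0 * ρ ^ m / ((m + 1).factorial : ℝ)) =
        C (a 0) * mk fun m => ρ ^ m / ((m + 1).factorial : ℝ) := by
      ext m; rw [coeff_C_mul, coeff_mk, coeff_mk, mul_div_assoc]
    have e2 : (mk fun m => a 0 * ρ ^ m) = C (a 0) * mk fun m => ρ ^ m := by
      ext m; rw [coeff_C_mul, coeff_mk, coeff_mk]
    have e3 : ∀ c : ℝ, rescale c (C (a 0)) = (C (a 0) : ℝ⟦X⟧) := fun c => by
      ext m
      rw [coeff_rescale, coeff_C]
      split_ifs with hm <;> simp [hm]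
    rw [e1, e2, mul_pow, ← map_pow, coeff_C_mul, coeff_pow_exp_eq]
    simp only [map_mul, e3, Finset.prod_mul_distrib, Finset.prod_const, Finset.card_range]
    rw [← map_pow, coeff_C_mul]
    ring
  induction m using Nat.strong_induction_on with
  | _ r ih =>
    obtain rfl | rfl | ⟨q, rfl⟩ : r = 0 ∨ r = 1 ∨ ∃ q, r = q + 2 := by
      rcases r with _ | _ | q
      · simp
      · simp
      · exact Or.inr (Or.inr ⟨q, rfl⟩)
    · simp
    · rw [pow_one, hρ]; field_simp
    · set r := q + 2 with hr
      have hA := coeff_prod_sub_coeff_prod (Finset.range n)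
        (fun _ => mk fun m => a m / ((m + 1).factorial : ℝ))
        (fun _ => mk fun m => a 0 * ρ ^ m / ((m + 1).factorial : ℝ)) (a 0) r
        (fun i _ => by simp [← coeff_zero_eq_constantCoeff_apply])
        (fun i _ => by simp [← coeff_zero_eq_constantCoeff_apply])
        (fun i _ m hm => by rw [coeff_mk, coeff_mk, ← ih m hm])
      have hB := coeff_prod_sub_coeff_prod (Finset.range n)
        (fun i => rescale ((i : ℝ) + 1) (mk a))
        (fun i => rescale ((i : ℝ) + 1) (mk fun m => a 0 * ρ ^ m)) (a 0) r
        (fun i _ => by simp [← coeff_zero_eq_constantCoeff_apply])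
        (fun i _ => by simp [← coeff_zero_eq_constantCoeff_apply])
        (fun i _ m hm => by rw [coeff_rescale, coeff_rescale, coeff_mk, coeff_mk, ← ih m hm])
      simp only [Finset.prod_const, Finset.card_range, h, hstar, coeff_mk, coeff_rescale,
        ← mul_sub, ← sub_div, Finset.sum_const, nsmul_eq_mul, ← Finset.sum_mul] at hA hB
      have hlt := mul_factorial_lt_factorial_mul_sum_pow hn q
      rw [← hr, show q + 3 = r + 1 by omega] at hlt
      have hlt' : (n : ℝ) * (n + r).factorial <
          n.factorial * (r + 1).factorial * ∑ i ∈ Finset.range n, ((i : ℝ) + 1) ^ r := by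
        exact_mod_cast hlt
      by_contra hne
      have hd : a r - a 0 * ρ ^ r ≠ 0 := sub_ne_zero.2 hne
      -- Both a and the geometric sequence solve the identity; subtracting leaves only the linear
      -- term in their difference at order r.
      have h3 : a 0 ^ n * ((n : ℝ) * ((a r - a 0 * ρ ^ r) / ((r + 1).factorial : ℝ))) =
          (n.factorial : ℝ) / ((n + r).factorial : ℝ) * (a 0 ^ n *
            ((∑ i ∈ Finset.range n, ((i : ℝ) + 1) ^ r) * (a r - a 0 * ρ ^ r))) := by
        rw [← hA, ← hB]; ring
      have := hfac (r + 1)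
      have := hfac (n + r)
      have han : a 0 ^ n ≠ 0 := pow_ne_zero _ h0
      field_simp at h3
      apply hlt'.ne
      linear_combination h3

/-! ### Everywhere convergent series and the Borel transform. -/

open PowerSeries in
/-- The power series `u` converges to `φ` at every point of `[0, ∞)`. -/
def SumsTo (u : ℝ⟦X⟧) (φ : ℝ → ℝ) : Prop :=
  ∀ x : ℝ, 0 ≤ x → HasSum (fun m => coeff m u * x ^ m) (φ x)

open PowerSeries in
/-- The formal Borel transform `∑ uₘ Xᵐ ↦ ∑ uₘ Xᵐ / m!`. -/
noncomputable def borelTransform (u : ℝ⟦X⟧) : ℝ⟦X⟧ :=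
  mk fun m => coeff m u / (m.factorial : ℝ)

theorem HasSum.sum_antidiagonal {F : ℕ × ℕ → ℝ} {S : ℝ} (h : HasSum F S) :
    HasSum (fun n => ∑ p ∈ Finset.HasAntidiagonal.antidiagonal n, F p) S := by
  have h1 := (Finset.HasAntidiagonal.sigmaAntidiagonalEquivProd (A := ℕ)).hasSum_iff.2 h
  exact h1.sigma fun n => Finset.hasSum (Finset.HasAntidiagonal.antidiagonal n) F

theorem HasSum.mul_real {f g : ℕ → ℝ} {s t : ℝ} (hf : HasSum f s) (hg : HasSum g t) :
    HasSum (fun p : ℕ × ℕ => f p.1 * g p.2) (s * t) :=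
  hf.mul hg (summable_mul_of_summable_norm hf.summable.norm hg.summable.norm)

open PowerSeries in
theorem SumsTo.mul {u v : ℝ⟦X⟧} {φ ψ : ℝ → ℝ} (hu : SumsTo u φ) (hv : SumsTo v ψ) :
    SumsTo (u * v) (fun x => φ x * ψ x) := by
  intro x hx
  have h := ((hu x hx).mul_real (hv x hx)).sum_antidiagonal
  convert! h using 2 with m
  rw [coeff_mul, Finset.sum_mul]
  refine Finset.sum_congr rfl fun p hp => ?_
  rw [← Finset.HasAntidiagonal.mem_antidiagonal.1 hp, pow_add]
  ring

open PowerSeries in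
theorem sumsTo_one : SumsTo 1 (fun _ => 1) := by
  intro x _
  convert hasSum_single (f := fun m => coeff m (1 : ℝ⟦X⟧) * x ^ m) 0 ?_ using 1
  · simp
  · intro m hm; simp [coeff_one, hm]

open PowerSeries in
theorem SumsTo.pow {u : ℝ⟦X⟧} {φ : ℝ → ℝ} (hu : SumsTo u φ) (n : ℕ) :
    SumsTo (u ^ n) (fun x => φ x ^ n) := by
  induction n with
  | zero => simpa using sumsTo_one
  | succ n ih => simpa only [pow_succ] using ih.mul hu

-- Convergence at x = 1 already gives a positive radius, and vanishing to the right of 0 suffices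
-- for the identity theorem.
open PowerSeries in
theorem SumsTo.unique {u v : ℝ⟦X⟧} {φ : ℝ → ℝ} (hu : SumsTo u φ) (hv : SumsTo v φ) : u = v := by
  set d : ℕ → ℝ := fun m => coeff m u - coeff m v with hd
  have hsum : ∀ x : ℝ, 0 ≤ x → HasSum (fun m => d m * x ^ m) 0 := fun x hx => by
    simpa only [hd, sub_mul, sub_self] using (hu x hx).sub (hv x hx)
  set p := FormalMultilinearSeries.ofScalars ℝ d with hp
  have hrad : 0 < p.radius := by
    refine lt_of_lt_of_le one_pos (p.le_radius_of_summable_norm (r := 1) ?_)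
    simpa [hp, FormalMultilinearSeries.ofScalars_norm] using (hsum 1 zero_le_one).summable.norm
  have hball := p.hasFPowerSeriesOnBall hrad
  have hzero : ∀ x : ℝ, 0 ≤ x → p.sum x = 0 := fun x hx => by
    have : p.sum x = ∑' m, d m * x ^ m := by
      simp [FormalMultilinearSeries.sum, hp, mul_comm]
    rw [this, (hsum x hx).tsum_eq]
  have hfreq : ∃ᶠ z in nhdsWithin (0 : ℝ) {0}ᶜ, p.sum z = 0 := by
    have h1 : ∃ᶠ z in nhdsWithin (0 : ℝ) (Set.Ioi 0), p.sum z = 0 :=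
      (show ∀ᶠ z in nhdsWithin (0 : ℝ) (Set.Ioi 0), p.sum z = 0 from
        eventually_nhdsWithin_of_forall fun z hz => hzero z (le_of_lt hz)).frequently
    exact h1.filter_mono (nhdsWithin_mono _ fun z hz => ne_of_gt hz)
  have hev := hball.analyticAt.frequently_zero_iff_eventually_zero.1 hfreq
  have hp0 := hball.hasFPowerSeriesAt.eq_zero_of_eventually hev
  have hd0 : d = 0 := (FormalMultilinearSeries.ofScalars_series_eq_zero ℝ).1 hp0
  ext m
  exact sub_eq_zero.1 (congrFun hd0 m)

/-- The Beta integral, by parts; it computes the convolution of two monomials. -/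
theorem integral_sub_pow_mul_pow (x : ℝ) (p q : ℕ) :
    ∫ y in (0 : ℝ)..x, (x - y) ^ p * y ^ q =
      (p.factorial : ℝ) * q.factorial / ((p + q + 1).factorial : ℝ) * x ^ (p + q + 1) := by
  induction p generalizing q with
  | zero =>
    have := q.factorial_ne_zero
    simp only [pow_zero, one_mul, integral_pow, zero_add, Nat.factorial_succ]
    push_cast
    field_simp
    simp
  | succ p ih =>
    have hderiv : ∀ y ∈ Set.uIcc 0 x, HasDerivAt (fun y => (x - y) ^ (p + 1) * y ^ (q + 1))
        (-(((p : ℝ) + 1) * ((x - y) ^ p * y ^ (q + 1))) +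
          ((q : ℝ) + 1) * ((x - y) ^ (p + 1) * y ^ q)) y := fun y _ => by
      have h1 : HasDerivAt (fun y => (x - y) ^ (p + 1)) (((p : ℝ) + 1) * (x - y) ^ p * (-1)) y := by
        convert! ((hasDerivAt_id y).const_sub x).pow (p + 1) using 1
        simp
      have h2 : HasDerivAt (fun y : ℝ => y ^ (q + 1)) (((q : ℝ) + 1) * y ^ q) y := by
        simpa using hasDerivAt_pow (q + 1) y
      convert! h1.mul h2 using 1
      ring
    have h := intervalIntegral.integral_eq_sub_of_hasDerivAt hderiv
      (Continuous.intervalIntegrable (by fun_prop) _ _)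
    rw [intervalIntegral.integral_add (Continuous.intervalIntegrable (by fun_prop) _ _)
      (Continuous.intervalIntegrable (by fun_prop) _ _), intervalIntegral.integral_neg,
      intervalIntegral.integral_const_mul, intervalIntegral.integral_const_mul, ih] at h
    simp only [sub_self, ne_eq, Nat.succ_ne_zero, not_false_eq_true, zero_pow, zero_mul,
      mul_zero] at h
    have hq : (q : ℝ) + 1 ≠ 0 := by positivity
    apply mul_left_cancel₀ hq
    rw [show p + (q + 1) + 1 = p + 1 + q + 1 by omega] at h
    have h' := neg_add_eq_zero.1 h
    rw [← h', Nat.factorial_succ p, Nat.factorial_succ q]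
    push_cast
    ring

open PowerSeries in
/-- Convolution on `[0, ∞)` corresponds to the product of the formal Laplace transforms. -/
theorem SumsTo.convolution {u v : ℝ⟦X⟧} {G g : ℝ → ℝ} (hu : SumsTo (borelTransform u) G)
    (hv : SumsTo (borelTransform v) g) :
    SumsTo (borelTransform (X * (u * v))) (fun x => ∫ y in (0 : ℝ)..x, G (x - y) * g y) := by
  intro x hx
  have hnorm : ∀ {w : ℝ⟦X⟧} {φ : ℝ → ℝ}, SumsTo w φ → ∀ z : ℝ, 0 ≤ z →
      Summable fun m => ‖coeff m w‖ * z ^ m := fun {w φ} hw z hz => by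
    have := (hw z hz).summable.norm
    simpa only [norm_mul, norm_pow, Real.norm_of_nonneg hz] using this
  have key : HasSum (fun p : ℕ × ℕ => ∫ y in (0 : ℝ)..x,
      (coeff p.1 (borelTransform u) * (x - y) ^ p.1) * (coeff p.2 (borelTransform v) * y ^ p.2))
      (∫ y in (0 : ℝ)..x, G (x - y) * g y) := by
    refine intervalIntegral.hasSum_integral_of_dominated_convergence
      (fun p _ => (‖coeff p.1 (borelTransform u)‖ * x ^ p.1) *
        (‖coeff p.2 (borelTransform v)‖ * x ^ p.2))
      (fun p => Continuous.aestronglyMeasurable (by fun_prop)) ?_ ?_ ?_ ?_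
    · intro p
      filter_upwards with y hy
      rw [Set.uIoc_of_le hx] at hy
      rw [norm_mul, norm_mul, norm_mul, norm_pow, norm_pow,
        Real.norm_of_nonneg (sub_nonneg.2 hy.2), Real.norm_of_nonneg hy.1.le]
      have h1 : x - y ≤ x := by linarith [hy.1]
      have h2 : 0 ≤ x - y := sub_nonneg.2 hy.2
      have h3 := hy.1.le
      have h4 := hy.2
      gcongr
    · filter_upwards with y _
      exact (hnorm hu x hx).mul_of_nonneg (hnorm hv x hx) (fun _ => by positivity)
        (fun _ => by positivity)
    · exact intervalIntegrable_const
    · filter_upwards with y hy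
      rw [Set.uIoc_of_le hx] at hy
      have h1 := hu (x - y) (sub_nonneg.2 hy.2)
      have h2 := hv y hy.1.le
      exact h1.mul_real h2
  have key' := key.sum_antidiagonal
  -- The factor X kills the constant term, and antidiagonal m supplies the coefficient of order m +
  -- 1.
  refine (hasSum_nat_add_iff' (f := fun m => coeff m (borelTransform (X * (u * v))) * x ^ m)
    1).1 ?_
  have h0 : coeff 0 (borelTransform (X * (u * v))) = 0 := by simp [borelTransform]
  rw [Finset.sum_range_one, h0, zero_mul, sub_zero]
  convert! key' using 2 with m
  rw [borelTransform, coeff_mk, coeff_succ_X_mul, coeff_mul, Finset.sum_div, Finset.sum_mul]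
  refine Finset.sum_congr rfl fun p hp => ?_
  have e : ∀ y : ℝ, coeff p.1 (borelTransform u) * (x - y) ^ p.1 *
      (coeff p.2 (borelTransform v) * y ^ p.2) =
      (coeff p.1 (borelTransform u) * coeff p.2 (borelTransform v)) * ((x - y) ^ p.1 * y ^ p.2) :=
    fun y => by ring
  simp only [e]
  rw [intervalIntegral.integral_const_mul, integral_sub_pow_mul_pow,
    Finset.HasAntidiagonal.mem_antidiagonal.1 hp, borelTransform, borelTransform, coeff_mk, coeff_mk]
  have := p.1.factorial_ne_zero
  have := p.2.factorial_ne_zero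
  field_simp

open PowerSeries in
theorem borelTransform_rescale (c : ℝ) (u : ℝ⟦X⟧) :
    borelTransform (rescale c u) = rescale c (borelTransform u) := by
  ext m
  simp only [borelTransform, coeff_mk, coeff_rescale, mul_div_assoc]

open PowerSeries in
theorem SumsTo.rescale {u : ℝ⟦X⟧} {φ : ℝ → ℝ} (hu : SumsTo u φ) {c : ℝ} (hc : 0 ≤ c) :
    SumsTo (PowerSeries.rescale c u) (fun x => φ (c * x)) := by
  intro x hx
  have h := hu (c * x) (mul_nonneg hc hx)
  convert h using 2 with m
  rw [coeff_rescale, mul_pow]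
  ring

open PowerSeries in
theorem SumsTo.const_mul {u : ℝ⟦X⟧} {φ : ℝ → ℝ} (hu : SumsTo u φ) (c : ℝ) :
    SumsTo (C c * u) (fun x => c * φ x) := by
  intro x hx
  simpa only [coeff_C_mul, mul_assoc] using (hu x hx).mul_left c

open PowerSeries in
theorem sumsTo_borelTransform_one : SumsTo (borelTransform 1) (fun _ => 1) := by
  convert sumsTo_one using 1
  ext m
  cases m with
  | zero => simp [borelTransform]
  | succ m => simp [borelTransform, coeff_one]

open PowerSeries in
theorem borelTransform_C_mul (c : ℝ) (u : ℝ⟦X⟧) :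
    borelTransform (C c * u) = C c * borelTransform u := by
  ext m
  simp only [borelTransform, coeff_mk, coeff_C_mul, mul_div_assoc]

/-! ### Distribution functions of the weighted sum and of the maximum. -/

open MeasureTheory ProbabilityTheory in
/-- Distribution function of the sum of two independent variables. -/
theorem measureReal_add_div_le {Ω : Type*} [MeasurableSpace Ω] {P : Measure Ω}
    [IsProbabilityMeasure P] {μ : Measure ℝ} [IsProbabilityMeasure μ] {S Y : Ω → ℝ}
    (hS : AEMeasurable S P) (hY : HasLaw Y μ P) (h : IndepFun S Y P) (c x : ℝ) :
    P.real {ω | S ω + Y ω / c ≤ x} = ∫ y, P.real {ω | S ω ≤ x - y / c} ∂μ := by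
  have hS' : HasLaw S (P.map S) P := ⟨hS, rfl⟩
  have hν : IsProbabilityMeasure (P.map S) := Measure.isProbabilityMeasure_map hS
  have hm : MeasurableSet {p : ℝ × ℝ | p.1 + p.2 / c ≤ x} :=
    measurableSet_le (by fun_prop) measurable_const
  have h1 := (h.hasLaw_prod hS' hY).measureReal_eq hm
  change P.real {ω | S ω + Y ω / c ≤ x} = _ at h1
  rw [h1, measureReal_def, Measure.prod_apply_symm hm, ← integral_toReal]
  · refine integral_congr_ae (Filter.Eventually.of_forall fun y => ?_)
    have e : (fun s => (s, y)) ⁻¹' {p : ℝ × ℝ | p.1 + p.2 / c ≤ x} = Set.Iic (x - y / c) := by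
      ext s
      simp [le_sub_iff_add_le]
    change ((P.map S) _).toReal = (P _).toReal
    rw [e, Measure.map_apply_of_aemeasurable hS measurableSet_Iic]
    rfl
  · exact (measurable_measure_prodMk_right hm).aemeasurable
  · exact Filter.Eventually.of_forall fun y => measure_lt_top _ _

open MeasureTheory in
theorem integral_eq_intervalIntegral_mul_density {μ : Measure ℝ} {f : ℝ → ℝ} (hf : IsDensity μ f)
    (h0 : μ (Set.Iic 0) = 0) {b : ℝ} (hb : 0 ≤ b) (φ : ℝ → ℝ) (hφ : ∀ y, b < y → φ y = 0) :
    ∫ y, φ y ∂μ = ∫ y in (0 : ℝ)..b, φ y * f y := by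
  have h1 : ∫ y in Set.Ioc 0 b, φ y ∂μ = ∫ y, φ y ∂μ := by
    refine setIntegral_eq_integral_of_ae_compl_eq_zero ?_
    have : ∀ᵐ y ∂μ, y ∉ Set.Iic (0 : ℝ) := measure_eq_zero_iff_ae_notMem.1 h0
    filter_upwards [this] with y hy hy'
    refine hφ y ?_
    by_contra hby
    exact hy' ⟨not_le.1 hy, not_lt.1 hby⟩
  rw [← h1, intervalIntegral.integral_of_le hb, hf.eq_withDensity,
    setIntegral_withDensity_eq_setIntegral_toReal_smul hf.measurable.ennreal_ofReal
      (Filter.Eventually.of_forall fun _ => ENNReal.ofReal_lt_top) _ measurableSet_Ioc]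
  refine integral_congr_ae (Filter.Eventually.of_forall fun y => ?_)
  simp only [ENNReal.toReal_ofReal (hf.nonneg y), smul_eq_mul]
  ring

open PowerSeries in
theorem HasMaclaurinExpansion.sumsTo {f : ℝ → ℝ} (hf : HasMaclaurinExpansion f) :
    SumsTo (borelTransform (mk fun q => iteratedDerivWithin q f (Set.Ici 0) 0)) f := by
  intro x hx
  simp only [borelTransform, coeff_mk]
  rcases hx.eq_or_lt with rfl | hx
  · convert! hasSum_single (f := fun m : ℕ =>
      iteratedDerivWithin m f (Set.Ici 0) 0 / (m.factorial : ℝ) * (0 : ℝ) ^ m) 0 ?_ using 1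
    · simp
    · intro m hm; simp [hm]
  · exact hf x hx

-- Adding Yᵢ/cᵢ convolves with the density cᵢ f(cᵢ x); its factor cᵢ and the X from the convolution
-- combine into the rescaling of X. The empty sum has distribution function 1 on [0, ∞).
open MeasureTheory ProbabilityTheory PowerSeries in
theorem sumsTo_measureReal_sum_le {Ω : Type*} [MeasurableSpace Ω] {P : Measure Ω}
    [IsProbabilityMeasure P] {μ : Measure ℝ} [IsProbabilityMeasure μ] {f : ℝ → ℝ} {a : ℕ → ℝ}
    (hf : IsDensity μ f) (h0 : μ (Set.Iic 0) = 0) (ha : SumsTo (borelTransform (mk a)) f)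
    {ι : Type*} {Y : ι → Ω → ℝ} (hlaw : ∀ i, HasLaw (Y i) μ P) (hindep : iIndepFun Y P)
    {c : ι → ℝ} (hc : ∀ i, 0 < c i) (s : Finset ι) :
    SumsTo (borelTransform (∏ i ∈ s, PowerSeries.rescale (c i) (X * mk a)))
      (fun x => P.real {ω | ∑ i ∈ s, Y i ω / c i ≤ x}) := by
  classical
  induction s using Finset.induction_on with
  | empty =>
    intro x hx
    simpa [hx] using sumsTo_borelTransform_one x hx
  | insert i s hi ih =>
    set S : Ω → ℝ := fun ω => ∑ j ∈ s, Y j ω / c j with hS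
    have hSm : AEMeasurable S P :=
      Finset.aemeasurable_fun_sum _ fun j _ => (hlaw j).aemeasurable.div_const _
    have hSind : IndepFun S (Y i) P := by
      -- Scale 1 at i leaves `Y i` itself undivided.
      have h1 : iIndepFun (fun j ω => Y j ω / (if j = i then 1 else c j)) P :=
        hindep.comp (fun j y => y / (if j = i then 1 else c j)) fun j => by fun_prop
      have h2 := h1.indepFun_finsetSum_of_notMem₀
        (fun j => (hlaw j).aemeasurable.div_const _) hi
      convert! h2 using 1
      · ext ω
        rw [Finset.sum_apply]
        refine Finset.sum_congr rfl fun j hj => ?_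
        rw [if_neg (ne_of_mem_of_not_mem hj hi)]
      · ext ω; simp
    have hpos : ∀ᵐ ω ∂P, 0 ≤ S ω := by
      have : ∀ j, ∀ᵐ ω ∂P, 0 ≤ Y j ω := fun j => by
        refine ((hlaw j).ae_iff (p := fun y => 0 ≤ y)
          (measurableSet_setOfPred.1 measurableSet_Ici)).2 ?_
        have : ∀ᵐ y ∂μ, y ∉ Set.Iic (0 : ℝ) := measure_eq_zero_iff_ae_notMem.1 h0
        filter_upwards [this] with y hy
        exact (not_le.1 hy).le
      have h' : ∀ᵐ ω ∂P, ∀ j ∈ s, 0 ≤ Y j ω :=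
        (Finset.eventually_all s).2 fun j _ => this j
      filter_upwards [h'] with ω hω
      exact Finset.sum_nonneg fun j hj => div_nonneg (hω j hj) (hc j).le
    have hG0 : ∀ z < 0, P.real {ω | S ω ≤ z} = 0 := fun z hz => by
      rw [measureReal_eq_zero_iff, measure_eq_zero_iff_ae_notMem]
      filter_upwards [hpos] with ω hω h
      exact absurd (le_trans hω h) (not_le.2 hz)
    have hdens : SumsTo (borelTransform (C (c i) * PowerSeries.rescale (c i) (mk a)))
        (fun x => c i * f (c i * x)) := by
      rw [borelTransform_C_mul, borelTransform_rescale]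
      exact (ha.rescale (hc i).le).const_mul _
    have hconv := ih.convolution hdens
    have e1 : X * ((∏ j ∈ s, PowerSeries.rescale (c j) (X * mk a)) *
        (C (c i) * PowerSeries.rescale (c i) (mk a))) =
        ∏ j ∈ insert i s, PowerSeries.rescale (c j) (X * mk a) := by
      rw [Finset.prod_insert hi, map_mul (PowerSeries.rescale (c i)), rescale_X]
      ring
    rw [e1] at hconv
    intro x hx
    convert! hconv x hx using 1
    have e2 : ∀ ω, ∑ j ∈ insert i s, Y j ω / c j = S ω + Y i ω / c i := fun ω => by
      rw [Finset.sum_insert hi, add_comm]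
    simp only [e2]
    rw [measureReal_add_div_le hSm (hlaw i) hSind (c i) x,
      integral_eq_intervalIntegral_mul_density hf h0 (mul_nonneg (hc i).le hx)]
    · have h3 := intervalIntegral.integral_comp_mul_left (a := 0) (b := x)
        (fun y => P.real {ω | S ω ≤ x - y / c i} * f y) (hc i).ne'
      rw [mul_zero] at h3
      rw [smul_eq_mul, eq_inv_mul_iff_mul_eq₀ (hc i).ne'] at h3
      rw [← h3, ← intervalIntegral.integral_const_mul]
      refine intervalIntegral.integral_congr fun y _ => ?_
      simp only [mul_div_cancel_left₀ _ (hc i).ne']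
      ring
    · intro y hy
      refine hG0 _ ?_
      rw [sub_neg, lt_div_iff₀ (hc i)]
      linarith

open MeasureTheory ProbabilityTheory in
theorem measureReal_sampleMax_le {Ω : Type*} [MeasurableSpace Ω] {P : Measure Ω}
    [IsProbabilityMeasure P] {μ : Measure ℝ} {n : ℕ} (hn : n ≠ 0) {Y : Fin n → Ω → ℝ}
    (hlaw : ∀ i, HasLaw (Y i) μ P) (hindep : iIndepFun Y P) (x : ℝ) :
    P.real {ω | sampleMax Y ω ≤ x} = μ.real (Set.Iic x) ^ n := by
  have : NeZero n := ⟨hn⟩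
  have e : {ω | sampleMax Y ω ≤ x} = ⋂ i, Y i ⁻¹' Set.Iic x := by
    ext ω
    simp [sampleMax, ciSup_le_iff (Set.finite_range fun i => Y i ω).bddAbove]
  rw [e, measureReal_def, hindep.meas_iInter fun i => ⟨Set.Iic x, measurableSet_Iic, rfl⟩]
  have h1 : ∀ i, P (Y i ⁻¹' Set.Iic x) = μ (Set.Iic x) := fun i =>
    (hlaw i).measure_eq (p := fun y => y ≤ x) measurableSet_Iic
  simp [h1, measureReal_def]

open PowerSeries in
theorem coeff_identity_of_borelTransform_prod_eq {n : ℕ} {a : ℕ → ℝ}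
    (h : borelTransform (∏ i ∈ Finset.range n, rescale ((i : ℝ) + 1) (X * mk a)) =
      borelTransform (X * mk a) ^ n) (r : ℕ) :
    coeff r ((mk fun m => a m / ((m + 1).factorial : ℝ)) ^ n) =
      (n.factorial : ℝ) / ((n + r).factorial : ℝ) *
        coeff r (∏ i ∈ Finset.range n, rescale ((i : ℝ) + 1) (mk a)) := by
  have e1 : borelTransform (X * mk a) = X * mk fun m => a m / ((m + 1).factorial : ℝ) := by
    ext m
    cases m with
    | zero => simp [borelTransform]
    | succ m => rw [borelTransform, coeff_mk, coeff_succ_X_mul, coeff_succ_X_mul, coeff_mk, coeff_mk]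
  have e2 : ∏ i ∈ Finset.range n, rescale ((i : ℝ) + 1) (X * mk a) =
      X ^ n * (C (n.factorial : ℝ) * ∏ i ∈ Finset.range n, rescale ((i : ℝ) + 1) (mk a)) := by
    simp only [map_mul, rescale_X, Finset.prod_mul_distrib, Finset.prod_const, Finset.card_range]
    rw [← map_prod, ← Finset.prod_range_add_one_eq_factorial]
    push_cast
    ring
  have h1 := congrArg (coeff (r + n)) h
  rw [e1, e2, mul_pow, coeff_X_pow_mul, borelTransform, coeff_mk, coeff_X_pow_mul,
    coeff_C_mul] at h1
  rw [← h1, add_comm r n]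
  ring

/-! ### Identification of the exponential law. -/

open PowerSeries ProbabilityTheory MeasureTheory in
theorem exists_eq_expMeasure_of_geometric {μ : Measure ℝ} [IsProbabilityMeasure μ]
    (h0 : cdf μ 0 = 0) {a : ℕ → ℝ} (ha0 : a 0 ≠ 0) (ha : ∀ m, a m = a 0 * (a 1 / a 0) ^ m)
    (hF : SumsTo (borelTransform (X * mk a)) (cdf μ)) :
    ∃ r : ℝ, 0 < r ∧ μ = expMeasure r := by
  set ρ := a 1 / a 0
  have hF' : ∀ x, 0 ≤ x →
      HasSum (fun m : ℕ => ρ ^ m / ((m + 1).factorial : ℝ) * x ^ (m + 1)) (cdf μ x / a 0) := by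
    intro x hx
    have h := (hasSum_nat_add_iff' 1).2 (hF x hx)
    have hz : coeff 0 (borelTransform (X * mk a)) = 0 := by simp [borelTransform]
    rw [Finset.sum_range_one, hz, zero_mul, sub_zero] at h
    convert! h.div_const (a 0) using 2 with m
    rw [borelTransform, coeff_mk, coeff_succ_X_mul, coeff_mk, ha m]
    field_simp
  have hρ : ρ < 0 := by
    by_contra hρ
    have hρ := not_lt.1 hρ
    -- For ρ ≥ 0 all terms are nonnegative, and at this point the first one, x, exceeds the bound
    -- |1/a₀| on F/a₀.
    have hx : (0 : ℝ) ≤ |1 / a 0| + 1 := by positivity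
    have h1 := le_hasSum (hF' _ hx) 0 fun m _ => by positivity
    have h2 : cdf μ (|1 / a 0| + 1) / a 0 ≤ |1 / a 0| := by
      refine (le_abs_self _).trans ?_
      rw [abs_div, abs_div, abs_one, abs_of_nonneg (cdf_nonneg _ _)]
      gcongr
      exact cdf_le_one _ _
    simp at h1 h2
    linarith
  have hFx : ∀ x, 0 ≤ x → cdf μ x = a 0 / ρ * (Real.exp (ρ * x) - 1) := by
    intro x hx
    have h1 : HasSum (fun m : ℕ => (ρ * x) ^ m / (m.factorial : ℝ)) (Real.exp (ρ * x)) := by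
      rw [Real.exp_eq_exp_ℝ]
      exact NormedSpace.expSeries_div_hasSum_exp (ρ * x)
    have h2 := (hasSum_nat_add_iff' 1).2 h1
    have h3 := (hF' x hx).mul_left ρ
    have h4 : ρ * (cdf μ x / a 0) = Real.exp (ρ * x) - 1 := by
      refine h3.unique ?_
      convert! h2 using 2 with m
      · rw [mul_pow]; ring
      · simp
    rw [← h4]
    have := hρ.ne
    field_simp
  have hlim : a 0 / ρ = -1 := by
    have h1 : Filter.Tendsto (fun x => a 0 / ρ * (Real.exp (ρ * x) - 1)) Filter.atTop
        (nhds (a 0 / ρ * (0 - 1))) := by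
      refine ((Real.tendsto_exp_atBot.comp ?_).sub_const 1).const_mul _
      exact Filter.tendsto_id.const_mul_atTop_of_neg hρ
    have h2 := (tendsto_cdf_atTop μ).congr' (f₂ := fun x => a 0 / ρ * (Real.exp (ρ * x) - 1))
      (by filter_upwards [Filter.eventually_ge_atTop 0] with x hx using hFx x hx)
    have := tendsto_nhds_unique h1 h2
    linarith
  refine ⟨-ρ, by linarith, ?_⟩
  have hp : IsProbabilityMeasure (expMeasure (-ρ)) := isProbabilityMeasure_expMeasure (by linarith)
  refine Measure.eq_of_cdf _ _ (StieltjesFunction.ext fun x => ?_)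
  rw [cdf_expMeasure_eq (by linarith)]
  split_ifs with hx
  · rw [hFx x hx, hlim]
    simp
  · exact le_antisymm (h0 ▸ monotone_cdf μ (not_le.1 hx).le) (cdf_nonneg _ _)

theorem mainTheorem4 {Ω : Type*} [MeasurableSpace Ω] (P : MeasureTheory.Measure Ω)
    [MeasureTheory.IsProbabilityMeasure P] (μ : MeasureTheory.Measure ℝ) (hμ : MemClassF μ)
    (n : ℕ) (hn : 2 ≤ n) (X : Fin n → Ω → ℝ)
    (hlaw : ∀ i, ProbabilityTheory.HasLaw (X i) μ P)
    (hindep : ProbabilityTheory.iIndepFun X P)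
    (hX : ProbabilityTheory.IdentDistrib (harmonicSum X) (sampleMax X) P P) :
    ∃ r : ℝ, 0 < r ∧ μ = ProbabilityTheory.expMeasure r := by
  have := hμ.isProbabilityMeasure
  obtain ⟨f, hf, hexp⟩ := hμ.exists_density
  set a : ℕ → ℝ := fun q => iteratedDerivWithin q f (Set.Ici 0) 0
  have h0 : μ (Set.Iic 0) = 0 := by
    rw [← ProbabilityTheory.ofReal_cdf, hμ.cdf_zero, ENNReal.ofReal_zero]
  have hsum := sumsTo_measureReal_sum_le (c := fun i : Fin n => (i : ℝ) + 1) hf h0 hexp.sumsTo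
    hlaw hindep fun i => by positivity
  have hcdf : SumsTo (borelTransform (PowerSeries.X * PowerSeries.mk a))
      (ProbabilityTheory.cdf μ) := by
    -- The first variable has weight 1, so its one-term sum yields the series of F itself.
    have h1 := hsum {⟨0, by omega⟩}
    simp only [Finset.prod_singleton, Finset.sum_singleton, Nat.cast_zero, zero_add, div_one,
      PowerSeries.rescale_one, RingHom.id_apply] at h1
    convert! h1 using 2 with x
    rw [ProbabilityTheory.cdf_eq_real]
    exact ((hlaw _).measureReal_eq (p := fun y => y ≤ x) measurableSet_Iic).symm
  have hprod := hsum Finset.univ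
  have hmax : SumsTo (borelTransform (PowerSeries.X * PowerSeries.mk a) ^ n)
      (fun x => P.real {ω | ∑ i, X i ω / ((i : ℝ) + 1) ≤ x}) := by
    convert! hcdf.pow n using 2 with x
    rw [ProbabilityTheory.cdf_eq_real, ← measureReal_sampleMax_le (by omega) hlaw hindep x]
    exact congrArg ENNReal.toReal (hX.measure_mem_eq (measurableSet_Iic (a := x)))
  have heq := hprod.unique hmax
  rw [Fin.prod_univ_eq_prod_range (fun i : ℕ =>
    PowerSeries.rescale ((i : ℝ) + 1) (PowerSeries.X * PowerSeries.mk a)) n] at heq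
  have hne : ∃ q, a q ≠ 0 := by
    by_contra! hall
    have hzero : ∀ x, 0 ≤ x → ProbabilityTheory.cdf μ x = 0 := fun x hx => by
      refine (hcdf x hx).unique ?_
      have : PowerSeries.mk a = 0 := by ext m; simp [hall m]
      simp [this, borelTransform]
    have h1 : Filter.Tendsto (fun _ : ℝ => (0 : ℝ)) Filter.atTop (nhds 1) :=
      (ProbabilityTheory.tendsto_cdf_atTop μ).congr'
        (by filter_upwards [Filter.eventually_ge_atTop 0] with x hx using hzero x hx)
    exact zero_ne_one (tendsto_nhds_unique tendsto_const_nhds h1)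
  obtain ⟨ha0, ha⟩ := exists_geometric_of_coeff_identity hn a hne
    (coeff_identity_of_borelTransform_prod_eq heq)
  exact exists_eq_expMeasure_of_geometric hμ.cdf_zero ha0 ha hcdf
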